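/- Let $\beta>3$, $w_0>0$ and $\lambda>0$ be constants and let $d=d(n)\in\mathbb{N}$ satisfy $d=\omega(\log n)$. For every $n$, let $G=G_n=\mathrm{GIRG}(n,\beta,w_0,d)$ be the following random graph with $n$ vertices (a standard geometric inhomogeneous random graph). Each vertex $v$ has a random weight $w_v$ with the Pareto distribution $\Pr[w_v\le x]=1-(x/w_0)^{1-\beta}$ for $x\ge w_0$, and a random position $\mathbf{x}_v$ uniformly distributed on the torus $\mathbb{T}^d=(\mathbb{R}/\mathbb{Z})^d$; all weights and positions are independent. Two vertices $u\ne v$ are adjacent if and only if $$\|\mathbf{x}_u-\mathbf{x}_v\|_\infty=\max_{1\le i\le d}|\mathbf{x}_{ui}-\mathbf{x}_{vi}|_C\;\le\;\frac12\left(\frac{\lambda w_uw_v}{n}\right)^{1/d},$$ where $|a-b|_C=\min\{|a-b|,1-|a-b|\}$ for $a,b\in[0,1)$ is the distance on the circle. Let $K_k$ be the number of cliques in $G$ on exactly $k$ vertices, and let $\omega(G)$ be the clique number of $G$. Then, as $n\to\infty$, $\mathbb{E}[K_k]=o(1)$ for $k\ge 4$, where $k$ is fixed or, more generally, $k=k(n)\ge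 4$ may be any function of $n$. Moreover, $\omega(G)\le 3$ asymptotically almost surely, that is, $\Pr[\omega(G)\le 3]\to 1$ as $n\to\infty$. -/

import Mathlib

open MeasureTheory ProbabilityTheory Filter Asymptotics
open scoped Topology ENNReal

noncomputable section

namespace GIRG

/-- The `d`-dimensional torus `(ℝ/ℤ)^d`. Its distance is the maximum over the coordinates of the
distance `min (|a - b|, 1 - |a - b|)` on the circle of circumference one (see `dist_coe_circle`),
and its `volume` is the uniform (Lebesgue) probability measure. -/
abbrev Torus (d : ℕ) : Type := Fin d → UnitAddCircle

/-- The distance on the circle between two points with representatives `a, b ∈ [0, 1]`. -/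
lemma dist_coe_circle (a b : ℝ) (ha : a ∈ Set.Icc (0 : ℝ) 1) (hb : b ∈ Set.Icc (0 : ℝ) 1) :
    dist (a : UnitAddCircle) (b : UnitAddCircle) = min |a - b| (1 - |a - b|) := by
  have key : ∀ t : ℝ, 0 ≤ t → t ≤ 1 → ‖(t : UnitAddCircle)‖ = min t (1 - t) := by
    intro t h0 h1
    rw [UnitAddCircle.norm_eq, abs_sub_round_eq_min]
    rcases h1.lt_or_eq with h | h
    · rw [Int.fract_eq_self.2 ⟨h0, h⟩]
    · subst h; simp
  rw [dist_eq_norm, ← AddCircle.coe_sub]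
  rcases le_total b a with h | h
  · rw [abs_of_nonneg (sub_nonneg.2 h)]
    exact key _ (sub_nonneg.2 h) (by linarith [ha.2, hb.1])
  · rw [← norm_neg, ← AddCircle.coe_neg, neg_sub, abs_sub_comm, abs_of_nonneg (sub_nonneg.2 h)]
    exact key _ (sub_nonneg.2 h) (by linarith [hb.2, ha.1])

/-- The data of `n` vertices: each has a weight and a position on the torus. -/
abbrev Config (n d : ℕ) : Type := Fin n → ℝ × Torus d

/-- The law of the vertex data: all weights and all positions are independent, the weights have the
Pareto distribution `ℙ(w ≤ x) = 1 - (x / w₀) ^ (1 - β)` for `x ≥ w₀`, that is, with scale `w₀` and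
shape `β - 1`, and the positions are uniform on the torus. -/
def law (n : ℕ) (β w₀ : ℝ) (d : ℕ) : Measure (Config n d) :=
  Measure.pi fun _ => (paretoMeasure w₀ (β - 1)).prod (volume : Measure (Torus d))

lemma isProbabilityMeasure_law (n : ℕ) {β w₀ : ℝ} (d : ℕ) (hβ : 1 < β) (hw₀ : 0 < w₀) :
    IsProbabilityMeasure (law n β w₀ d) := by
  have : IsProbabilityMeasure (paretoMeasure w₀ (β - 1)) :=
    isProbabilityMeasure_paretoMeasure hw₀ (by linarith)
  have : IsProbabilityMeasure (volume : Measure UnitAddCircle) :=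
    ⟨by simp⟩
  unfold law
  infer_instance

/-- The connection threshold `½ (lam * w_u * w_v / n) ^ (1 / d)`. -/
def threshold (lam : ℝ) (n d : ℕ) (a b : ℝ) : ℝ :=
  1 / 2 * (lam * a * b / n) ^ (1 / (d : ℝ))

/-- The geometric inhomogeneous random graph determined by the vertex data `ω`. -/
def graph (lam : ℝ) {n d : ℕ} (ω : Config n d) : SimpleGraph (Fin n) where
  Adj u v := u ≠ v ∧ dist (ω u).2 (ω v).2 ≤ threshold lam n d (ω u).1 (ω v).1
  symm := ⟨fun u v h => ⟨h.1.symm, by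
    have h2 := h.2
    rw [dist_comm, threshold, mul_right_comm] at h2
    exact h2⟩⟩
  loopless := ⟨fun _ h => h.1 rfl⟩

/-- The number of cliques on exactly `k` vertices. -/
def numCliques {V : Type*} (G : SimpleGraph V) (k : ℕ) : ℕ := (G.cliqueSet k).ncard

/-- The expected number of `k`-cliques. -/
def expectedCliques (lam : ℝ) (n : ℕ) (β w₀ : ℝ) (d k : ℕ) : ℝ≥0∞ :=
  ∫⁻ ω, (numCliques (graph lam ω) k : ℝ≥0∞) ∂(law n β w₀ d)

end GIRG

end

namespace GIRG

/-- A truncated Bonferroni inequality for pairwise independent events. -/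
lemma measureReal_inter_compl_le {Ω ι : Type*} [MeasurableSpace Ω] [DecidableEq ι] (μ : Measure Ω)
    [IsProbabilityMeasure μ] (E : Finset ι) (A : ι → Set Ω) (hA : ∀ i, MeasurableSet (A i))
    (hind : ∀ i ∈ E, ∀ j ∈ E, i ≠ j → μ.real (A i ∩ A j) = μ.real (A i) * μ.real (A j)) :
    μ.real (⋂ i ∈ E, (A i)ᶜ) ≤
      1 - ∑ i ∈ E, μ.real (A i) + (∑ i ∈ E, μ.real (A i)) ^ 2 / 2 := by
  classical
  set f : ι → Ω → ℝ := fun i => (A i).indicator 1 with hf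
  have hfi : ∀ i, Integrable (f i) μ := fun i =>
    (integrable_const (1 : ℝ)).indicator (hA i)
  have hff : ∀ i j, (fun ω => f i ω * f j ω) = (A i ∩ A j).indicator 1 := by
    intro i j; ext ω
    by_cases h1 : ω ∈ A i <;> by_cases h2 : ω ∈ A j <;> simp [hf, h1, h2]
  have hffi : ∀ i j, Integrable (fun ω => f i ω * f j ω) μ := fun i j => by
    rw [hff]; exact (integrable_const (1 : ℝ)).indicator ((hA i).inter (hA j))
  have hm : MeasurableSet (⋂ i ∈ E, (A i)ᶜ) :=
    Finset.measurableSet_biInter _ fun i _ => (hA i).compl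
  have hsq : ∀ ω, (∑ i ∈ E, f i ω) ^ 2 = ∑ i ∈ E, ∑ j ∈ E, f i ω * f j ω := fun ω => by
    rw [sq, Finset.sum_mul_sum]
  have hpt : ∀ ω, (⋂ i ∈ E, (A i)ᶜ).indicator (1 : Ω → ℝ) ω ≤
      1 - 3 / 2 * ∑ i ∈ E, f i ω + (∑ i ∈ E, ∑ j ∈ E, f i ω * f j ω) / 2 := by
    intro ω
    rw [← hsq]
    have hN : ∑ i ∈ E, f i ω = ((E.filter fun i => ω ∈ A i).card : ℝ) := by
      simp [hf, Set.indicator_apply, Finset.sum_boole]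
    rw [hN]
    by_cases h : ω ∈ ⋂ i ∈ E, (A i)ᶜ
    · have : (E.filter fun i => ω ∈ A i) = ∅ := by
        ext i; simp only [Set.mem_iInter, Set.mem_compl_iff] at h; simpa using h i
      simp [this, h]
    · rw [Set.indicator_of_notMem h]
      generalize (E.filter fun i => ω ∈ A i).card = N
      rcases N with _ | _ | N
      · simp
      · norm_num
      · push_cast
        have : (0 : ℝ) ≤ N := N.cast_nonneg
        nlinarith
  have hi1 : Integrable (fun ω => ∑ i ∈ E, f i ω) μ := integrable_finsetSum _ fun i _ => hfi i
  have hi2 : Integrable (fun ω => ∑ i ∈ E, ∑ j ∈ E, f i ω * f j ω) μ :=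
    integrable_finsetSum _ fun i _ => integrable_finsetSum _ fun j _ => hffi i j
  have key := integral_mono ((integrable_const (1 : ℝ)).indicator hm)
    (((integrable_const (1 : ℝ)).sub (hi1.const_mul (3 / 2))).add (hi2.div_const 2)) hpt
  have e1 : ∫ ω, ∑ i ∈ E, f i ω ∂μ = ∑ i ∈ E, μ.real (A i) := by
    rw [integral_finsetSum _ fun i _ => hfi i]
    exact Finset.sum_congr rfl fun i _ => integral_indicator_one (hA i)
  have e2 : ∫ ω, ∑ i ∈ E, ∑ j ∈ E, f i ω * f j ω ∂μ ≤
      (∑ i ∈ E, μ.real (A i)) ^ 2 + ∑ i ∈ E, μ.real (A i) := by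
    rw [integral_finsetSum _ fun i _ => integrable_finsetSum _ fun j _ => hffi i j, sq,
      Finset.sum_mul_sum, ← Finset.sum_add_distrib]
    refine Finset.sum_le_sum fun i hi => ?_
    rw [integral_finsetSum _ fun j _ => hffi i j]
    have : μ.real (A i) = ∑ j ∈ E, if i = j then μ.real (A i) else 0 := by simp [hi]
    refine (Finset.sum_le_sum (g := fun j => μ.real (A i) * μ.real (A j) +
      if i = j then μ.real (A i) else 0) fun j hj => ?_).trans_eq
      (by rw [Finset.sum_add_distrib, ← this])
    rw [hff, integral_indicator_one ((hA i).inter (hA j))]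
    split_ifs with h
    · subst h; rw [Set.inter_self]; nlinarith [mul_self_nonneg (μ.real (A i))]
    · rw [hind i hi j hj h, add_zero]
  have e3 : ∫ ω, (⋂ i ∈ E, (A i)ᶜ).indicator (fun _ => (1 : ℝ)) ω ∂μ =
      μ.real (⋂ i ∈ E, (A i)ᶜ) := integral_indicator_one hm
  have e4 := integral_add ((integrable_const (1 : ℝ)).sub (hi1.const_mul (3 / 2)))
    (hi2.div_const 2)
  have e5 := integral_sub (integrable_const (1 : ℝ)) (hi1.const_mul (3 / 2))
  simp only [Pi.add_apply, Pi.sub_apply] at key e4 e5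
  rw [e3] at key
  rw [e4, e5, integral_const_mul, integral_div, e1] at key
  simp only [integral_const, probReal_univ, smul_eq_mul, mul_one] at key
  linarith

instance : IsProbabilityMeasure (volume : Measure UnitAddCircle) := ⟨by simp⟩

/-- Two differences `x u - x v` and `x u' - x v'` of independent uniform points are jointly uniform
if `v'` is not among `u, v`. -/
lemma measurePreserving_differences {ι : Type*} [Fintype ι] {u v u' v' : ι}
    (huv : u ≠ v) (huv' : u' ≠ v') (hu : v' ≠ u) (hv : v' ≠ v) :
    MeasurePreserving (fun x : ι → UnitAddCircle => (x u - x v, x u' - x v'))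
      volume (volume.prod volume) := by
  classical
  let f : (ι → UnitAddCircle) →+ UnitAddCircle × UnitAddCircle :=
    { toFun := fun x => (x u - x v, x u' - x v')
      map_zero' := by simp
      map_add' := fun x y => by ext <;> simp <;> abel }
  have hc : Continuous f := by
    change Continuous fun x : ι → UnitAddCircle => (x u - x v, x u' - x v')
    fun_prop
  refine AddMonoidHom.measurePreserving (f := f) hc ?_ (by simp [volume_pi])
  rintro ⟨a, b⟩
  refine ⟨fun z => if z = v' then (if u' = u then a - b else -b) else if z = u then a else 0, ?_⟩
  change (_, _) = _
  ext
  · simp [hu.symm, hv.symm, huv.symm]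
  · simp only [huv', if_false, if_true]
    split_ifs <;> simp

lemma measurePreserving_difference {ι : Type*} [Fintype ι] {u v : ι} (huv : u ≠ v) :
    MeasurePreserving (fun x : ι → UnitAddCircle => x u - x v) volume volume := by
  classical
  let f : (ι → UnitAddCircle) →+ UnitAddCircle :=
    { toFun := fun x => x u - x v
      map_zero' := by simp
      map_add' := fun x y => by simp; abel }
  have hc : Continuous f := by
    change Continuous fun x : ι → UnitAddCircle => x u - x v
    fun_prop
  refine AddMonoidHom.measurePreserving (f := f) hc ?_ (by simp [volume_pi])
  exact fun a => ⟨fun z => if z = u then a else 0, by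
    simp [f, huv.symm]⟩

lemma measureReal_lt_dist {ι : Type*} [Fintype ι] {u v : ι} (huv : u ≠ v) {t : ℝ} (ht : 0 ≤ t) :
    volume.real {x : ι → UnitAddCircle | t < dist (x u) (x v)} = 1 - min 1 (2 * t) := by
  have h : {x : ι → UnitAddCircle | t < dist (x u) (x v)} =
      (fun x : ι → UnitAddCircle => x u - x v) ⁻¹' (Metric.closedBall 0 t)ᶜ := by
    ext x; simp [dist_eq_norm]
  rw [h, (measurePreserving_difference huv).measureReal_preimage
    measurableSet_closedBall.compl.nullMeasurableSet,
    probReal_compl_eq_one_sub measurableSet_closedBall, measureReal_def,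
    AddCircle.volume_closedBall, ENNReal.toReal_ofReal (by positivity)]

lemma measureReal_lt_dist_inter {ι : Type*} [Fintype ι] {u v u' v' : ι}
    (huv : u ≠ v) (huv' : u' ≠ v') (hne : s(u, v) ≠ s(u', v')) (t t' : ℝ) :
    volume.real ({x : ι → UnitAddCircle | t < dist (x u) (x v)} ∩
      {x : ι → UnitAddCircle | t' < dist (x u') (x v')}) =
    volume.real {x : ι → UnitAddCircle | t < dist (x u) (x v)} *
      volume.real {x : ι → UnitAddCircle | t' < dist (x u') (x v')} := by
  wlog h : v' ≠ u ∧ v' ≠ v generalizing u' v'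
  · have h' : u' ≠ u ∧ u' ≠ v := by
      simp only [ne_eq, Sym2.eq_iff] at hne
      grind
    have := this huv'.symm (by rwa [Sym2.eq_swap (a := v')]) h'
    simpa only [dist_comm (_ : UnitAddCircle)] using this
  have hS : ∀ t : ℝ, MeasurableSet (Metric.closedBall (0 : UnitAddCircle) t)ᶜ :=
    fun t => measurableSet_closedBall.compl
  have hp := measurePreserving_differences huv huv' h.1 h.2
  have e : ∀ (a b : ι) (t : ℝ), {x : ι → UnitAddCircle | t < dist (x a) (x b)} =
      (fun x : ι → UnitAddCircle => x a - x b) ⁻¹' (Metric.closedBall 0 t)ᶜ := by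
    intro a b t; ext x; simp [dist_eq_norm]
  have e2 : {x : ι → UnitAddCircle | t < dist (x u) (x v)} ∩
      {x : ι → UnitAddCircle | t' < dist (x u') (x v')} =
      (fun x : ι → UnitAddCircle => (x u - x v, x u' - x v')) ⁻¹'
        ((Metric.closedBall 0 t)ᶜ ×ˢ (Metric.closedBall 0 t')ᶜ) := by
    ext x; simp [dist_eq_norm]
  rw [e2, hp.measureReal_preimage ((hS t).prod (hS t')).nullMeasurableSet, measureReal_prod_prod,
    e u v, e u' v', (measurePreserving_difference huv).measureReal_preimage
      (hS t).nullMeasurableSet, (measurePreserving_difference huv').measureReal_preimage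
      (hS t').nullMeasurableSet]

/-- The pairs `(u, v)` with `u < v` of elements of `s`. -/
def pairs {n : ℕ} (s : Finset (Fin n)) : Finset (Fin n × Fin n) :=
  (s ×ˢ s).filter fun e => e.1 < e.2

/-- The probability that a single coordinate allows all the edges in `s`. -/
lemma measureReal_forall_dist_le {n : ℕ} (s : Finset (Fin n)) (t : Fin n × Fin n → ℝ)
    (ht : ∀ e ∈ pairs s, 0 ≤ t e) :
    volume.real {x : Fin n → UnitAddCircle | ∀ e ∈ pairs s, dist (x e.1) (x e.2) ≤ t e} ≤
      1 - ∑ e ∈ pairs s, (1 - min 1 (2 * t e)) +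
        (∑ e ∈ pairs s, (1 - min 1 (2 * t e))) ^ 2 / 2 := by
  have hlt : ∀ e ∈ pairs s, e.1 < e.2 := fun e he => (Finset.mem_filter.1 he).2
  have h := measureReal_inter_compl_le (volume : Measure (Fin n → UnitAddCircle)) (pairs s)
    (fun e => {x | t e < dist (x e.1) (x e.2)})
    (fun e => measurableSet_lt (by fun_prop) (by fun_prop))
    (fun e he e' he' hne => measureReal_lt_dist_inter (hlt e he).ne (hlt e' he').ne (by
      simp only [ne_eq, Sym2.eq_iff]
      rintro (⟨h1, h2⟩ | ⟨h1, h2⟩)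
      · exact hne (Prod.ext h1 h2)
      · exact lt_asymm (hlt e he) (by rw [h1, h2]; exact hlt e' he')) _ _)
  rw [Finset.sum_congr rfl fun e he => measureReal_lt_dist (hlt e he).ne (ht e he)] at h
  refine le_trans (le_of_eq ?_) h
  congr 1
  ext x
  simp

@[to_additive]
lemma prod_pairs {n : ℕ} {M : Type*} [CommMonoid M] (s : Finset (Fin n)) (g : Fin n → M) :
    ∏ e ∈ pairs s, g e.1 * g e.2 = ∏ u ∈ s, g u ^ (s.card - 1) := by
  rw [pairs, Finset.prod_filter, Finset.prod_product]
  have h : ∀ u v, (if u < v then g u * g v else 1) =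
      (if u < v then g u else 1) * (if u < v then g v else 1) := by
    intro u v; split_ifs <;> simp
  simp only [h, Finset.prod_mul_distrib]
  rw [Finset.prod_comm (f := fun u v => if u < v then g v else 1), ← Finset.prod_mul_distrib]
  refine Finset.prod_congr rfl fun u hu => ?_
  rw [← Finset.prod_mul_distrib, ← Finset.card_erase_of_mem hu, ← Finset.prod_const,
    ← Finset.mul_prod_erase s _ hu]
  simp only [lt_irrefl, if_false, one_mul]
  refine Finset.prod_congr rfl fun v hv => ?_
  rcases lt_or_gt_of_ne (Finset.ne_of_mem_erase hv) with h | h <;> simp [h, h.not_gt]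

lemma one_sub_add_sq_le_exp {ι : Type*} (E : Finset ι) (y : ι → ℝ) {η κ : ℝ} (hη : η ≤ 1)
    (hy0 : ∀ e ∈ E, 0 ≤ y e) (hy : ∀ e ∈ E, y e ≤ η) (hE : E.card * η ≤ 2)
    (hκ : κ ≤ (1 - η) * (1 - E.card * η / 2)) :
    1 - ∑ e ∈ E, (1 - Real.exp (-y e)) + (∑ e ∈ E, (1 - Real.exp (-y e))) ^ 2 / 2 ≤
      Real.exp (-(κ * ∑ e ∈ E, y e)) := by
  set m := ∑ e ∈ E, (1 - Real.exp (-y e))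
  set Y := ∑ e ∈ E, y e
  have hY0 : 0 ≤ Y := Finset.sum_nonneg hy0
  have hYη : Y ≤ E.card * η := by
    rw [← nsmul_eq_mul]; exact Finset.sum_le_card_nsmul _ _ _ hy
  have hmY : m ≤ Y := Finset.sum_le_sum fun e _ => by linarith [Real.add_one_le_exp (-y e)]
  have hm : (1 - η) * Y ≤ m := by
    rw [Finset.mul_sum]
    refine Finset.sum_le_sum fun e he => ?_
    have h0 := hy0 e he
    have h1 := hy e he
    have h2 : Real.exp (-y e) ≤ 1 / (1 + y e) := by
      rw [Real.exp_neg, ← one_div]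
      exact one_div_le_one_div_of_le (by linarith) (by linarith [Real.add_one_le_exp (y e)])
    have h3 : 1 / (1 + y e) ≤ 1 - (1 - η) * y e := by
      rw [div_le_iff₀ (by linarith)]
      nlinarith [mul_nonneg (h0.trans h1) (sq_nonneg (y e)), mul_nonneg h0 (sub_nonneg.2 h1)]
    linarith
  have h1 : κ * Y ≤ m * (1 - m / 2) :=
    calc κ * Y ≤ (1 - η) * (1 - E.card * η / 2) * Y := by gcongr
      _ = ((1 - η) * Y) * (1 - E.card * η / 2) := by ring
      _ ≤ m * (1 - m / 2) := by
        have : 0 ≤ (1 - η) * Y := mul_nonneg (by linarith) hY0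
        exact mul_le_mul hm (by linarith) (by linarith) (by linarith)
  have h2 := Real.add_one_le_exp (-(m * (1 - m / 2)))
  calc _ = -(m * (1 - m / 2)) + 1 := by ring
    _ ≤ _ := h2
    _ ≤ _ := Real.exp_le_exp.2 (by linarith)

instance (d : ℕ) : BorelSpace (Torus d) := Pi.borelSpace

instance (d : ℕ) : (volume : Measure (Torus d)).IsAddHaarMeasure :=
  inferInstanceAs (Measure.pi fun _ => volume).IsAddHaarMeasure

lemma measurePreserving_swap (n d : ℕ) :
    MeasurePreserving (fun (x : Fin n → Torus d) (i : Fin d) (v : Fin n) => x v i)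
      volume volume := by
  let f : (Fin n → Torus d) →+ (Fin d → Fin n → UnitAddCircle) :=
    { toFun := fun x i v => x v i
      map_zero' := rfl
      map_add' := fun _ _ => rfl }
  have hc : Continuous f := by
    change Continuous fun (x : Fin n → Torus d) (i : Fin d) (v : Fin n) => x v i
    fun_prop
  have : (volume : Measure (Fin n → Torus d)).IsAddHaarMeasure :=
    Measure.pi.isAddHaarMeasure _
  have : (volume : Measure (Fin d → Fin n → UnitAddCircle)).IsAddHaarMeasure :=
    Measure.pi.isAddHaarMeasure _
  exact AddMonoidHom.measurePreserving (f := f) hc (fun y => ⟨fun v i => y i v, rfl⟩)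
    (by simp [volume_pi])

/-- The probability that `s` is a clique when the weights are given. -/
lemma volume_positions_le {n d : ℕ} (hn : 0 < n) (hd : 0 < d) {lam : ℝ} (hlam : 0 < lam)
    (s : Finset (Fin n)) (w : Fin n → ℝ) (hw : ∀ u ∈ s, 0 < w u) {η κ c : ℝ} (hη0 : 0 ≤ η)
    (hη : η ≤ 1) (hE : (pairs s).card * η ≤ 2) (hκ : κ ≤ (1 - η) * (1 - (pairs s).card * η / 2))
    (hcκ : c ≤ κ) (hc : 0 ≤ c)
    (hL : ∀ e ∈ pairs s, -Real.log (lam * w e.1 * w e.2 / n) / d ≤ η) :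
    volume {x : Fin n → Torus d | ∀ e ∈ pairs s,
      dist (x e.1) (x e.2) ≤ threshold lam n d (w e.1) (w e.2)} ≤
    ENNReal.ofReal (∏ e ∈ pairs s, (lam * w e.1 * w e.2 / n) ^ c) := by
  set a : Fin n × Fin n → ℝ := fun e => lam * w e.1 * w e.2 / n
  have hn' : (0 : ℝ) < n := by exact_mod_cast hn
  have hd' : (0 : ℝ) < d := by exact_mod_cast hd
  have ha : ∀ e ∈ pairs s, 0 < a e := fun e he => by
    have h := Finset.mem_product.1 (Finset.mem_filter.1 he).1
    have := hw _ h.1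
    have := hw _ h.2
    positivity
  set t : Fin n × Fin n → ℝ := fun e => threshold lam n d (w e.1) (w e.2)
  set y : Fin n × Fin n → ℝ := fun e => max 0 (-Real.log (a e) / d)
  have ht0 : ∀ e ∈ pairs s, 0 ≤ t e := fun e he =>
    mul_nonneg (by norm_num) (Real.rpow_nonneg (ha e he).le _)
  have hty : ∀ e ∈ pairs s, min 1 (2 * t e) = Real.exp (-y e) := fun e he => by
    have h1 : 2 * t e = Real.exp (Real.log (a e) / d) := by
      change 2 * (1 / 2 * a e ^ (1 / (d : ℝ))) = _
      rw [Real.rpow_def_of_pos (ha e he)]; ring_nf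
    rw [h1, ← Real.exp_zero, ← Real.exp_strictMono.monotone.map_min, ← min_neg_neg]
    simp [neg_div]
  set Q : Set (Fin n → UnitAddCircle) := {x | ∀ e ∈ pairs s, dist (x e.1) (x e.2) ≤ t e}
  have hQm : MeasurableSet Q := by
    have : Q = ⋂ e ∈ pairs s, {x | dist (x e.1) (x e.2) ≤ t e} := by ext; simp [Q]
    rw [this]
    exact Finset.measurableSet_biInter _ fun e _ => measurableSet_le (by fun_prop) (by fun_prop)
  have hQ : volume.real Q ≤ Real.exp (-(κ * ∑ e ∈ pairs s, y e)) := by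
    have h := measureReal_forall_dist_le s t ht0
    rw [Finset.sum_congr rfl fun e he => by rw [hty e he]] at h
    exact h.trans (one_sub_add_sq_le_exp _ y hη (fun _ _ => le_max_left _ _)
      (fun e he => max_le hη0 (hL e he)) hE hκ)
  have hset : {x : Fin n → Torus d | ∀ e ∈ pairs s, dist (x e.1) (x e.2) ≤ t e} =
      (fun (x : Fin n → Torus d) (i : Fin d) (v : Fin n) => x v i) ⁻¹'
        (Set.univ.pi fun _ => Q) := by
    ext x
    simp only [Set.mem_ofPred_eq, Set.mem_preimage, Set.mem_univ_pi, Q]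
    refine ⟨fun h i e he => (dist_pi_le_iff (ht0 e he)).1 (h e he) i,
      fun h e he => (dist_pi_le_iff (ht0 e he)).2 fun i => h i e he⟩
  rw [hset, (measurePreserving_swap n d).measure_preimage
    (MeasurableSet.univ_pi fun _ => hQm).nullMeasurableSet, volume_pi, Measure.pi_pi,
    Finset.prod_const, Finset.card_univ, Fintype.card_fin,
    ← ofReal_measureReal, ← ENNReal.ofReal_pow measureReal_nonneg]
  refine ENNReal.ofReal_le_ofReal ?_
  calc volume.real Q ^ d ≤ Real.exp (-(κ * ∑ e ∈ pairs s, y e)) ^ d := by gcongr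
    _ = ∏ e ∈ pairs s, Real.exp (-(κ * (d * y e))) := by
      rw [← Real.exp_nat_mul, ← Real.exp_sum, Finset.sum_neg_distrib, Finset.mul_sum,
        mul_neg, Finset.mul_sum]
      simp only [mul_left_comm]
    _ ≤ _ := by
      refine Finset.prod_le_prod (fun _ _ => (Real.exp_pos _).le) fun e he => ?_
      rw [Real.rpow_def_of_pos (ha e he)]
      refine Real.exp_le_exp.2 ?_
      have h0 : 0 ≤ d * y e := mul_nonneg hd'.le (le_max_left _ _)
      have h1 : -Real.log (a e) ≤ d * y e := by
        rw [← div_le_iff₀' hd']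
        exact le_max_right _ _
      change _ ≤ Real.log (a e) * c
      nlinarith [mul_le_mul_of_nonneg_right hcκ h0]

lemma lintegral_rpow_paretoMeasure_lt_top {w₀ r τ : ℝ} (hw₀ : 0 < w₀) (hτ : τ < r) :
    ∫⁻ x, ENNReal.ofReal (x ^ τ) ∂(paretoMeasure w₀ r) < ∞ := by
  have hm : Measurable (paretoPDF w₀ r) := (measurable_paretoPDFReal w₀ r).ennreal_ofReal
  have hi : Integrable ((Set.Ici w₀).indicator fun x : ℝ => r * w₀ ^ r * x ^ (-(r + 1) + τ)) := by
    refine IntegrableOn.integrable_indicator ?_ measurableSet_Ici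
    exact ((integrableOn_Ici_iff_integrableOn_Ioi (μ := volume)).2
      (integrableOn_Ioi_rpow_of_lt (by linarith) hw₀)).const_mul _
  rw [paretoMeasure, lintegral_withDensity_eq_lintegral_mul _ hm (by fun_prop)]
  refine lt_of_le_of_lt (lintegral_mono fun x => ?_) hi.lintegral_lt_top
  by_cases hx : w₀ ≤ x
  · have hx0 : 0 < x := hw₀.trans_le hx
    rw [Set.indicator_of_mem (show x ∈ Set.Ici w₀ from hx), Pi.mul_apply, paretoPDF_of_le hx,
      ← ENNReal.ofReal_mul' (by positivity), mul_assoc, ← Real.rpow_add hx0]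
  · rw [Pi.mul_apply, paretoPDF_of_lt (not_le.1 hx), zero_mul]
    exact zero_le

lemma ae_le_paretoMeasure (w₀ r : ℝ) : ∀ᵐ x ∂(paretoMeasure w₀ r), w₀ ≤ x := by
  have h : {x | ¬ w₀ ≤ x} = Set.Iio w₀ := by ext; simp
  rw [ae_iff, h, paretoMeasure, withDensity_apply _ measurableSet_Iio,
    lintegral_paretoPDF_of_le le_rfl]

lemma threshold_comm (lam : ℝ) (n d : ℕ) (a b : ℝ) :
    threshold lam n d a b = threshold lam n d b a := by
  rw [threshold, threshold, mul_right_comm]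

lemma isClique_graph_iff (lam : ℝ) {n d : ℕ} (ω : Config n d) (s : Finset (Fin n)) :
    (graph lam ω).IsClique s ↔ ∀ u ∈ s, ∀ v ∈ s, u < v →
      dist (ω u).2 (ω v).2 ≤ threshold lam n d (ω u).1 (ω v).1 := by
  refine ⟨fun h u hu v hv huv => (h hu hv huv.ne).2, fun h u hu v hv huv => ⟨huv, ?_⟩⟩
  rcases lt_or_gt_of_ne huv with h' | h'
  · exact h u hu v hv h'
  · rw [dist_comm, threshold_comm]; exact h v hv u hu h'

lemma isClique_graph_iff_pairs (lam : ℝ) {n d : ℕ} (ω : Config n d) (s : Finset (Fin n)) :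
    (graph lam ω).IsClique s ↔ ∀ e ∈ pairs s,
      dist (ω e.1).2 (ω e.2).2 ≤ threshold lam n d (ω e.1).1 (ω e.2).1 := by
  rw [isClique_graph_iff]
  simp only [pairs, Finset.mem_filter, Finset.mem_product, Prod.forall]
  grind

@[fun_prop]
lemma measurable_threshold (lam : ℝ) (n d : ℕ) {α : Type*} [MeasurableSpace α] {f g : α → ℝ}
    (hf : Measurable f) (hg : Measurable g) :
    Measurable fun x => threshold lam n d (f x) (g x) := by
  unfold threshold; fun_prop

lemma measurableSet_isClique (lam : ℝ) (n d : ℕ) (s : Finset (Fin n)) :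
    MeasurableSet {ω : Config n d | (graph lam ω).IsClique s} := by
  have : {ω : Config n d | (graph lam ω).IsClique s} = ⋂ e ∈ pairs s,
      {ω | dist (ω e.1).2 (ω e.2).2 ≤ threshold lam n d (ω e.1).1 (ω e.2).1} := by
    ext ω; simp [isClique_graph_iff_pairs]
  rw [this]
  exact Finset.measurableSet_biInter _ fun e _ => measurableSet_le (by fun_prop) (by fun_prop)

lemma card_pairs_le {n : ℕ} {s : Finset (Fin n)} (hs : s.card ≤ 7) : (pairs s).card ≤ 21 := by
  have h := sum_pairs s (fun _ => (1 : ℕ))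
  simp only [Finset.sum_const, smul_eq_mul, mul_one] at h
  have : s.card * (s.card - 1) ≤ 7 * 6 := Nat.mul_le_mul hs (by omega)
  omega

lemma prod_pairs_rpow {n : ℕ} {lam τ : ℝ} (hlam : 0 < lam) {s : Finset (Fin n)} (hs : 2 ≤ s.card)
    {w : Fin n → ℝ} (hw : ∀ u ∈ s, 0 < w u) :
    ∏ e ∈ pairs s, (lam * w e.1 * w e.2 / n) ^ (τ / (s.card - 1 : ℕ)) =
      ∏ u ∈ s, ((lam / n) ^ (τ / 2) * w u ^ τ) := by
  have hb : 0 ≤ lam / n := by positivity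
  have hj : ((s.card - 1 : ℕ) : ℝ) ≠ 0 := by
    rw [Nat.cast_ne_zero]; omega
  have h1 : ∀ e ∈ pairs s, (lam * w e.1 * w e.2 / n) ^ (τ / (s.card - 1 : ℕ)) =
      (√(lam / n) * w e.1) ^ (τ / (s.card - 1 : ℕ)) *
        (√(lam / n) * w e.2) ^ (τ / (s.card - 1 : ℕ)) := fun e he => by
    have h := Finset.mem_product.1 (Finset.mem_filter.1 he).1
    have h1 := hw _ h.1
    have h2 := hw _ h.2
    rw [← Real.mul_rpow (by positivity) (by positivity), mul_mul_mul_comm, Real.mul_self_sqrt hb]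
    congr 1; ring
  rw [Finset.prod_congr rfl h1,
    prod_pairs s fun u => (√(lam / n) * w u) ^ (τ / (s.card - 1 : ℕ))]
  refine Finset.prod_congr rfl fun u hu => ?_
  have h2 := hw u hu
  rw [← Real.rpow_natCast, ← Real.rpow_mul (by positivity), div_mul_cancel₀ _ hj,
    Real.mul_rpow (by positivity) h2.le, Real.sqrt_eq_rpow, ← Real.rpow_mul hb]
  congr 2; ring

/-- The factor that every vertex contributes to the bound on the probability of a clique. -/
noncomputable def vertexFactor (lam : ℝ) (n : ℕ) (β w₀ τ : ℝ) : ℝ≥0∞ :=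
  ENNReal.ofReal ((lam / n) ^ (τ / 2)) *
    ∫⁻ x, ENNReal.ofReal (x ^ τ) ∂(paretoMeasure w₀ (β - 1))

lemma lintegral_pi_prod {ι α : Type*} [Fintype ι] [MeasurableSpace α] (ν : Measure α)
    [IsProbabilityMeasure ν] {f : α → ℝ≥0∞} (hf : Measurable f) (s : Finset ι) :
    ∫⁻ w, ∏ u ∈ s, f (w u) ∂(Measure.pi fun _ : ι => ν) = (∫⁻ x, f x ∂ν) ^ s.card := by
  have hind : iIndepFun (fun (u : ι) (w : ι → α) => f (w u)) (Measure.pi fun _ : ι => ν) :=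
    iIndepFun_pi (X := fun _ => f) fun _ => hf.aemeasurable
  refine (lintegral_prod_eq_prod_lintegral_of_indepFun s _ hind
    fun u => hf.comp (measurable_pi_apply u)).trans ?_
  rw [← Finset.prod_const]
  exact Finset.prod_congr rfl fun u _ =>
    (measurePreserving_eval (fun _ : ι => ν) u).lintegral_comp hf

lemma lintegral_prod_rpow (n : ℕ) {β w₀ τ b : ℝ} (hβ : 1 < β) (hw₀ : 0 < w₀) (hb : 0 ≤ b)
    (s : Finset (Fin n)) :
    ∫⁻ w, ∏ u ∈ s, ENNReal.ofReal (b * w u ^ τ)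
        ∂(Measure.pi fun _ : Fin n => paretoMeasure w₀ (β - 1)) =
      (ENNReal.ofReal b * ∫⁻ x, ENNReal.ofReal (x ^ τ) ∂(paretoMeasure w₀ (β - 1))) ^ s.card := by
  have : IsProbabilityMeasure (paretoMeasure w₀ (β - 1)) :=
    isProbabilityMeasure_paretoMeasure hw₀ (by linarith)
  have hm : Measurable fun x : ℝ => ENNReal.ofReal (x ^ τ) := by fun_prop
  simp only [ENNReal.ofReal_mul hb]
  rw [lintegral_pi_prod _ (hm.const_mul _), lintegral_const_mul _ hm]

/-- The probability of a clique, by first choosing the weights and then the positions. -/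
lemma law_isClique_eq_lintegral (n d : ℕ) {β w₀ : ℝ} (lam : ℝ) (hβ : 1 < β) (hw₀ : 0 < w₀)
    (s : Finset (Fin n)) :
    law n β w₀ d {ω | (graph lam ω).IsClique s} =
      ∫⁻ w, volume {x : Fin n → Torus d | ∀ e ∈ pairs s,
          dist (x e.1) (x e.2) ≤ threshold lam n d (w e.1) (w e.2)}
        ∂(Measure.pi fun _ : Fin n => paretoMeasure w₀ (β - 1)) := by
  have : IsProbabilityMeasure (paretoMeasure w₀ (β - 1)) :=
    isProbabilityMeasure_paretoMeasure hw₀ (by linarith)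
  set S : Set ((Fin n → ℝ) × (Fin n → Torus d)) := ⋂ e ∈ pairs s,
    {p | dist (p.2 e.1) (p.2 e.2) ≤ threshold lam n d (p.1 e.1) (p.1 e.2)} with hSdef
  have hS : MeasurableSet S :=
    Finset.measurableSet_biInter _ fun e _ => measurableSet_le (by fun_prop) (by fun_prop)
  have hpre : {ω : Config n d | (graph lam ω).IsClique s} =
      MeasurableEquiv.arrowProdEquivProdArrow ℝ (Torus d) (Fin n) ⁻¹' S := by
    ext ω
    rw [Set.mem_ofPred_eq, isClique_graph_iff_pairs]
    simp only [hSdef, Set.mem_preimage, Set.mem_iInter]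
    rfl
  rw [hpre, law, (measurePreserving_arrowProdEquivProdArrow ℝ (Torus d) (Fin n)
    (fun _ => paretoMeasure w₀ (β - 1)) fun _ => volume).measure_preimage hS.nullMeasurableSet,
    Measure.prod_apply hS]
  refine lintegral_congr fun w => ?_
  rw [volume_pi]
  congr 1
  ext x
  simp [hSdef]

lemma law_isClique_le_of_card_le {n d : ℕ} (hn : 0 < n) (hd : 0 < d) {β w₀ lam τ η : ℝ}
    (hβ : 1 < β) (hw₀ : 0 < w₀) (hlam : 0 < lam) (hτ : 0 ≤ τ) (hη0 : 0 ≤ η) (hη : 21 * η ≤ 2)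
    (hητ : τ / 3 ≤ (1 - η) * (1 - 21 * η / 2)) (hL : -Real.log (lam * w₀ * w₀ / n) / d ≤ η)
    (s : Finset (Fin n)) (hs4 : 4 ≤ s.card) (hs7 : s.card ≤ 7) :
    law n β w₀ d {ω | (graph lam ω).IsClique s} ≤ vertexFactor lam n β w₀ τ ^ s.card := by
  have : IsProbabilityMeasure (paretoMeasure w₀ (β - 1)) :=
    isProbabilityMeasure_paretoMeasure hw₀ (by linarith)
  have hn' : (0 : ℝ) < n := by exact_mod_cast hn
  have hae : ∀ᵐ w ∂(Measure.pi fun _ : Fin n => paretoMeasure w₀ (β - 1)), ∀ u, w₀ ≤ w u :=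
    ae_all_iff.2 fun u => (Measure.quasiMeasurePreserving_eval
      (fun _ : Fin n => paretoMeasure w₀ (β - 1)) u).ae (ae_le_paretoMeasure w₀ (β - 1))
  have hcard : ((pairs s).card : ℝ) ≤ 21 := by exact_mod_cast card_pairs_le hs7
  have hcη : (pairs s).card * η ≤ 21 * η := mul_le_mul_of_nonneg_right hcard hη0
  have hs3 : (3 : ℝ) ≤ (s.card - 1 : ℕ) := by
    have : 3 ≤ s.card - 1 := by omega
    exact_mod_cast this
  have hκ : τ / 3 ≤ (1 - η) * (1 - (pairs s).card * η / 2) :=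
    hητ.trans (mul_le_mul_of_nonneg_left (by linarith) (by linarith))
  rw [law_isClique_eq_lintegral n d lam hβ hw₀, vertexFactor,
    ← lintegral_prod_rpow n hβ hw₀ (by positivity)]
  refine lintegral_mono_ae ?_
  filter_upwards [hae] with w hw
  have hw0 : ∀ u, 0 < w u := fun u => hw₀.trans_le (hw u)
  rw [← ENNReal.ofReal_prod_of_nonneg fun u _ =>
      mul_nonneg (by positivity) (Real.rpow_nonneg (hw0 u).le _),
    ← prod_pairs_rpow hlam (by omega) fun u _ => hw0 u]
  refine volume_positions_le hn hd hlam s w (fun u _ => hw0 u) hη0 (by linarith)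
    (hcη.trans hη) hκ (div_le_div_of_nonneg_left hτ (by norm_num) hs3) (by positivity)
    fun e _ => le_trans ?_ hL
  have h1 := hw e.1
  have h2 := hw e.2
  have h3 := hw0 e.1
  gcongr

/-- Cliques on disjoint vertex sets are independent. -/
lemma law_isClique_inter {n d : ℕ} {β w₀ lam : ℝ} (hβ : 1 < β) (hw₀ : 0 < w₀)
    {s t : Finset (Fin n)} (hst : Disjoint s t) :
    law n β w₀ d ({ω | (graph lam ω).IsClique s} ∩ {ω | (graph lam ω).IsClique t}) =
      law n β w₀ d {ω | (graph lam ω).IsClique s} *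
        law n β w₀ d {ω | (graph lam ω).IsClique t} := by
  have : IsProbabilityMeasure (paretoMeasure w₀ (β - 1)) :=
    isProbabilityMeasure_paretoMeasure hw₀ (by linarith)
  have hind : iIndepFun (fun (i : Fin n) (ω : Config n d) => ω i) (law n β w₀ d) :=
    iIndepFun_pi (X := fun _ x => x) fun _ => by fun_prop
  let D (t : Finset (Fin n)) : Set (t → ℝ × Torus d) := {z | ∀ u v : t, u < v →
    dist (z u).2 (z v).2 ≤ threshold lam n d (z u).1 (z v).1}
  have hD : ∀ t, MeasurableSet (D t) := fun t => by
    have : D t = ⋂ (u : t) (v : t) (_ : u < v),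
        {z | dist (z u).2 (z v).2 ≤ threshold lam n d (z u).1 (z v).1} := by ext; simp [D]
    rw [this]
    exact .iInter fun u => .iInter fun v => .iInter fun _ =>
      measurableSet_le (by fun_prop) (by fun_prop)
  have hpre : ∀ t : Finset (Fin n), {ω : Config n d | (graph lam ω).IsClique t} =
      (fun (ω : Config n d) (i : t) => ω i) ⁻¹' D t := fun t => by
    ext ω
    simp [isClique_graph_iff, D]
  rw [hpre s, hpre t]
  exact (hind.indepFun_finset s t hst fun i => by fun_prop).measure_inter_preimage_eq_mul _ _
    (hD s) (hD t)

lemma law_isClique_le {n d : ℕ} (hn : 0 < n) (hd : 0 < d) {β w₀ lam τ η : ℝ}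
    (hβ : 1 < β) (hw₀ : 0 < w₀) (hlam : 0 < lam) (hτ : 0 ≤ τ) (hη0 : 0 ≤ η) (hη : 21 * η ≤ 2)
    (hητ : τ / 3 ≤ (1 - η) * (1 - 21 * η / 2)) (hL : -Real.log (lam * w₀ * w₀ / n) / d ≤ η)
    (s : Finset (Fin n)) (hs : 4 ≤ s.card) :
    law n β w₀ d {ω | (graph lam ω).IsClique s} ≤ vertexFactor lam n β w₀ τ ^ s.card := by
  induction s using Finset.strongInduction with
  | H s ih =>
    rcases le_or_gt s.card 7 with h7 | h7
    · exact law_isClique_le_of_card_le hn hd hβ hw₀ hlam hτ hη0 hη hητ hL s hs h7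
    obtain ⟨t, hts, ht⟩ := Finset.exists_subset_card_eq hs
    have hc := Finset.card_sdiff_add_card_eq_card hts
    have h1 := law_isClique_le_of_card_le hn hd hβ hw₀ hlam hτ hη0 hη hητ hL t (by omega) (by omega)
    have h2 := ih (s \ t) (Finset.sdiff_ssubset hts (Finset.card_pos.1 (by omega))) (by omega)
    calc law n β w₀ d {ω | (graph lam ω).IsClique s}
        ≤ law n β w₀ d ({ω | (graph lam ω).IsClique (s \ t : Finset (Fin n))} ∩
          {ω | (graph lam ω).IsClique t}) :=
          measure_mono fun ω hω => ⟨hω.subset (by simp), hω.subset (by simpa using hts)⟩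
      _ ≤ vertexFactor lam n β w₀ τ ^ (s \ t).card * vertexFactor lam n β w₀ τ ^ t.card := by
        rw [law_isClique_inter hβ hw₀ Finset.sdiff_disjoint]
        gcongr
      _ = _ := by rw [← pow_add, hc]

lemma numCliques_eq_sum (lam : ℝ) {n d : ℕ} (ω : Config n d) (k : ℕ) :
    (numCliques (graph lam ω) k : ℝ≥0∞) = ∑ s ∈ Finset.powersetCard k (Finset.univ : Finset (Fin n)),
      {ω : Config n d | (graph lam ω).IsClique s}.indicator 1 ω := by
  classical
  have : (graph lam ω).cliqueSet k =
      ((Finset.powersetCard k Finset.univ).filter fun s : Finset (Fin n) =>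
        (graph lam ω).IsClique s : Finset (Finset (Fin n))) := by
    ext s
    simp [SimpleGraph.mem_cliqueSet_iff, SimpleGraph.isNClique_iff, and_comm]
  rw [numCliques, this, Set.ncard_coe_finset, Finset.card_filter, Nat.cast_sum]
  refine Finset.sum_congr rfl fun s _ => ?_
  simp [Set.indicator_apply]

lemma expectedCliques_eq_sum (lam : ℝ) (n : ℕ) (β w₀ : ℝ) (d k : ℕ) :
    expectedCliques lam n β w₀ d k = ∑ s ∈ Finset.powersetCard k (Finset.univ : Finset (Fin n)),
      law n β w₀ d {ω | (graph lam ω).IsClique s} := by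
  simp only [expectedCliques, numCliques_eq_sum]
  rw [lintegral_finsetSum _ fun s _ => measurable_one.indicator (measurableSet_isClique lam n d s)]
  exact Finset.sum_congr rfl fun s _ => lintegral_indicator_one (measurableSet_isClique lam n d s)

lemma expectedCliques_le {n d : ℕ} (hn : 0 < n) (hd : 0 < d) {β w₀ lam τ η : ℝ}
    (hβ : 1 < β) (hw₀ : 0 < w₀) (hlam : 0 < lam) (hτ : 0 ≤ τ) (hη0 : 0 ≤ η) (hη : 21 * η ≤ 2)
    (hητ : τ / 3 ≤ (1 - η) * (1 - 21 * η / 2)) (hL : -Real.log (lam * w₀ * w₀ / n) / d ≤ η)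
    {k : ℕ} (hk : 4 ≤ k) :
    expectedCliques lam n β w₀ d k ≤ (n * vertexFactor lam n β w₀ τ) ^ k := by
  rw [expectedCliques_eq_sum]
  calc _ ≤ ∑ s ∈ Finset.powersetCard k (Finset.univ : Finset (Fin n)),
        vertexFactor lam n β w₀ τ ^ k := Finset.sum_le_sum fun s hs => by
        have hsk := (Finset.mem_powersetCard.1 hs).2
        have h := law_isClique_le hn hd hβ hw₀ hlam hτ hη0 hη hητ hL s (by omega)
        rwa [hsk] at h
    _ = (n.choose k : ℝ≥0∞) * vertexFactor lam n β w₀ τ ^ k := by simp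
    _ ≤ _ := by
      rw [mul_pow]
      gcongr
      exact_mod_cast Nat.choose_le_pow n k

lemma tendsto_mul_vertexFactor {lam β w₀ τ : ℝ} (hlam : 0 < lam) (hw₀ : 0 < w₀) (hτ : 2 < τ)
    (hτβ : τ < β - 1) :
    Tendsto (fun n : ℕ => (n : ℝ≥0∞) * vertexFactor lam n β w₀ τ) atTop (𝓝 0) := by
  have h1 : Tendsto (fun n : ℕ => lam ^ (τ / 2) * (n : ℝ) ^ (-(τ / 2 - 1))) atTop (𝓝 0) := by
    have := ((tendsto_rpow_neg_atTop (y := τ / 2 - 1) (by linarith)).comp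
      tendsto_natCast_atTop_atTop).const_mul (lam ^ (τ / 2))
    rwa [mul_zero] at this
  have h2 := ENNReal.Tendsto.mul_const (ENNReal.tendsto_ofReal h1)
    (Or.inr (lintegral_rpow_paretoMeasure_lt_top (r := β - 1) hw₀ hτβ).ne)
  rw [ENNReal.ofReal_zero, zero_mul] at h2
  refine h2.congr' ?_
  filter_upwards [eventually_gt_atTop 0] with n hn
  have hn' : (0 : ℝ) < n := by exact_mod_cast hn
  rw [vertexFactor, ← mul_assoc, ← ENNReal.ofReal_natCast, ← ENNReal.ofReal_mul hn'.le]
  congr 2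
  rw [Real.div_rpow hlam.le hn'.le, neg_sub, Real.rpow_sub hn', Real.rpow_one]
  ring

lemma eventually_neg_log_div_le {d : ℕ → ℕ} {a η : ℝ} (ha : 0 < a) (hη : 0 < η)
    (hd : (fun n : ℕ => Real.log n) =o[atTop] (fun n : ℕ => (d n : ℝ))) :
    ∀ᶠ n : ℕ in atTop, 0 < d n ∧ -Real.log (a / n) / d n ≤ η := by
  have hlog : Tendsto (fun n : ℕ => Real.log n) atTop atTop :=
    Real.tendsto_log_atTop.comp tendsto_natCast_atTop_atTop
  filter_upwards [hd.bound (half_pos hη), hlog.eventually_gt_atTop 0,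
    hlog.eventually_ge_atTop (-Real.log a), eventually_gt_atTop 0] with n h1 h2 h3 hn
  have hn' : (n : ℝ) ≠ 0 := by exact_mod_cast hn.ne'
  rw [Real.norm_of_nonneg h2.le, Real.norm_of_nonneg (Nat.cast_nonneg _)] at h1
  have hd0 : 0 < d n := by
    rcases Nat.eq_zero_or_pos (d n) with h | h
    · rw [h] at h1; simp at h1; linarith
    · exact h
  refine ⟨hd0, ?_⟩
  rw [div_le_iff₀ (by exact_mod_cast hd0), Real.log_div ha.ne' hn']
  linarith

lemma tendsto_expectedCliques {β w₀ lam : ℝ} (hβ : 3 < β) (hw₀ : 0 < w₀) (hlam : 0 < lam)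
    {d : ℕ → ℕ} (hd : (fun n : ℕ => Real.log n) =o[atTop] (fun n : ℕ => (d n : ℝ)))
    {k : ℕ → ℕ} (hk : ∀ n, 4 ≤ k n) :
    Tendsto (fun n : ℕ => expectedCliques lam n β w₀ (d n) (k n)) atTop (𝓝 0) := by
  obtain ⟨τ, hτ2, hτ⟩ := exists_between (lt_min (by linarith : 2 < β - 1) (by norm_num : (2 : ℝ) < 3))
  have hτβ := hτ.trans_le (min_le_left _ _)
  have hτ3 := hτ.trans_le (min_le_right _ _)
  set η : ℝ := (1 - τ / 3) * (2 / 23) with hη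
  have hη0 : 0 < η := mul_pos (by linarith) (by norm_num)
  have hF := tendsto_mul_vertexFactor hlam hw₀ hτ2 hτβ
  have hF4 := ENNReal.Tendsto.pow (n := 4) hF
  rw [zero_pow (by norm_num)] at hF4
  refine tendsto_of_tendsto_of_tendsto_of_le_of_le' tendsto_const_nhds hF4
    (Eventually.of_forall fun _ => zero_le) ?_
  filter_upwards [eventually_neg_log_div_le (a := lam * w₀ * w₀) (by positivity) hη0 hd,
    hF.eventually_le_const one_pos, eventually_gt_atTop 0] with n hn hF1 hn0
  refine (expectedCliques_le (τ := τ) hn0 hn.1 (by linarith) hw₀ hlam (by linarith) hη0.le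
    (by linarith) (by nlinarith [sq_nonneg η]) hn.2 (hk n)).trans ?_
  exact pow_le_pow_right_of_le_one' hF1 (hk n)

lemma one_le_law_cliqueNum_add {n : ℕ} {β w₀ : ℝ} (lam : ℝ) (d : ℕ) (hβ : 1 < β) (hw₀ : 0 < w₀) :
    1 ≤ law n β w₀ d {ω | (graph lam ω).cliqueNum ≤ 3} + expectedCliques lam n β w₀ d 4 := by
  have := isProbabilityMeasure_law n d hβ hw₀
  rw [expectedCliques_eq_sum, ← measure_univ (μ := law n β w₀ d)]
  have hsub : (Set.univ : Set (Config n d)) ⊆ {ω | (graph lam ω).cliqueNum ≤ 3} ∪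
      ⋃ s ∈ Finset.powersetCard 4 (Finset.univ : Finset (Fin n)),
        {ω | (graph lam ω).IsClique s} := by
    intro ω _
    by_cases h : (graph lam ω).cliqueNum ≤ 3
    · exact Or.inl h
    · obtain ⟨s, hs⟩ := (graph lam ω).exists_isNClique_cliqueNum
      have hs4 : 4 ≤ s.card := by rw [hs.card_eq]; omega
      obtain ⟨t, hts, ht⟩ := Finset.exists_subset_card_eq hs4
      have hmem : t ∈ Finset.powersetCard 4 (Finset.univ : Finset (Fin n)) :=
        Finset.mem_powersetCard.2 ⟨Finset.subset_univ t, ht⟩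
      exact Or.inr (Set.mem_biUnion hmem (hs.isClique.subset (Finset.coe_subset.2 hts)))
  exact (measure_mono hsub).trans ((measure_union_le _ _).trans
    (add_le_add le_rfl (measure_biUnion_finset_le _ _)))

end GIRG

theorem mainTheorem6 (β w₀ lam : ℝ) (hβ : 3 < β) (hw₀ : 0 < w₀) (hlam : 0 < lam)
    (d : ℕ → ℕ) (hd : (fun n : ℕ => Real.log n) =o[atTop] (fun n : ℕ => (d n : ℝ))) :
    (∀ k : ℕ → ℕ, (∀ n, 4 ≤ k n) →
      Tendsto (fun n : ℕ => GIRG.expectedCliques lam n β w₀ (d n) (k n)) atTop (𝓝 0)) ∧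
    Tendsto (fun n : ℕ => GIRG.law n β w₀ (d n)
      {ω | (GIRG.graph lam ω).cliqueNum ≤ 3}) atTop (𝓝 1) := by
  refine ⟨fun k hk => GIRG.tendsto_expectedCliques hβ hw₀ hlam hd hk, ?_⟩
  have h := GIRG.tendsto_expectedCliques hβ hw₀ hlam hd (k := fun _ => 4) fun _ => le_rfl
  have h1 := ENNReal.Tendsto.sub (tendsto_const_nhds (x := (1 : ℝ≥0∞))) h
    (Or.inl ENNReal.one_ne_top)
  rw [tsub_zero] at h1
  refine tendsto_of_tendsto_of_tendsto_of_le_of_le h1 tendsto_const_nhds (fun n => ?_) fun n => ?_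
  · exact tsub_le_iff_right.2 (GIRG.one_le_law_cliqueNum_add lam (d n) (by linarith) hw₀)
  · have := GIRG.isProbabilityMeasure_law n (d n) (by linarith : 1 < β) hw₀
    exact prob_le_one
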